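/- Let $(\Omega,\mu)$ be a $\sigma$-finite non-atomic measure space and let $\mathcal M(\Omega,\mu)$ be the space of ($\mu$-a.e. classes of) real- or complex-valued $\mu$-measurable functions on $\Omega$. For $f\in\mathcal M(\Omega,\mu)$ and $t>0$ put $$f^*(t)=\inf\{s\ge 0:\mu(\{|f|>s\})\le t\},\qquad f^{**}(t)=\frac1t\int_0^t f^*(u)\,du .$$ For an interval $I\subset(0,\infty)$, $\|\cdot\|_{q,I}$ is the (quasi-)norm of $L_q(I)$ with respect to Lebesgue measure, and $1/\infty=0$, $1/0=\infty$. A positive Lebesgue measurable function $b:(0,\infty)\to(0,\infty)$ is \emph{slowly varying} if for every $\varepsilon>0$ the function $t^{\varepsilon}b(t)$ is equivalent (up to multiplicative constants) to an increasing function on $(0,\infty)$ and $t^{-\varepsilon}b(t)$ is equivalent to a decreasing one. Let $L_1,L_\infty$ be the Lebesgue spaces on $(\Omega,\mu)$ and let $L_{1,\infty}$ be the space of all $f\in\mathcal M(\Omega,\mu)$ with $\|f\|_{1,\infty}=\|t f^*(t)\|_{\infty,(0,\infty)}<\infty$. For $A_0\in\{L_1,L_{1,\infty}\}$, $A_1=L_\infty$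 and $f\in A_0+A_1$ let $$K(t,f)=K(t,f;A_0,A_1)=\inf\{\|f_0\|_{A_0}+t\|f_1\|_{A_1}: f=f_0+f_1,\ f_i\in A_i\}\quad(t>0),$$ and let $(A_0,A_1)^{\mathcal L}_{\theta,r,b,q,a}$ be the space of all $f\in A_0+A_1$ with $$\Big\|t^{-1/r}b(t)\,\big\|u^{-\theta-1/q}a(u)K(u,f)\big\|_{q,(0,t)}\Big\|_{r,(0,\infty)}<\infty .$$ Let $L^{\mathcal L}_{p,r,b,q,a}$ be the space of all $f\in\mathcal M(\Omega,\mu)$ with $$\Big\|t^{-1/r}b(t)\,\big\|u^{1/p-1/q}a(u)f^{*}(u)\big\|_{q,(0,t)}\Big\|_{r,(0,\infty)}<\infty ,$$ let $(L)^{\mathcal L}_{p,r,b,q,a}$ be defined in the same way with $f^{**}$ in place of $f^*$, and let $L^{(p,q,r}_b$ and $(L)^{(p,q,r}_b$ be the small Lorentz--Karamata spaces, defined by the same two expressions without the factor $a(u)$. Equality of two of these spaces means that they have the same elements and equivalent quasi-norms. \textbf{Theorem.} Let $0<\theta\le 1$, $p=\frac1{1-\theta}$ (so $p=\infty$ if $\theta=1$),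 $0<q,r\le\infty$, and let $a,b$ be slowly varying. Then $$(L_1,L_\infty)^{\mathcal L}_{\theta,r,b,q,a}=(L_{1,\infty},L_\infty)^{\mathcal L}_{\theta,r,b,q,a}=(L)^{\mathcal L}_{p,r,b,q,a}=L^{\mathcal L}_{p,r,b,q,a}.$$ In particular, $$(L_1,L_\infty)^{\mathcal L}_{\theta,r,b,q,1}=(L_{1,\infty},L_\infty)^{\mathcal L}_{\theta,r,b,q,1}=(L)^{(p,q,r}_{b}=L^{(p,q,r}_{b}.$$ -/

import Mathlib

open MeasureTheory Set
open scoped ENNReal NNReal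

noncomputable section

namespace LimitInterp

/-- `μ` has no atoms: every measurable set of positive measure splits into two measurable parts of
positive measure. -/
def IsNonatomic {Ω : Type*} [MeasurableSpace Ω] (μ : Measure Ω) : Prop :=
  ∀ s, MeasurableSet s → 0 < μ s → ∃ t, t ⊆ s ∧ MeasurableSet t ∧ 0 < μ t ∧ 0 < μ (s \ t)

/-- Two positive functions on `(0,∞)` are equivalent: `C⁻¹ ψ ≤ φ ≤ C ψ` for some constant `C`. -/
def EquivOnPos (φ ψ : ℝ → ℝ) : Prop :=
  ∃ C : ℝ, 0 < C ∧ ∀ t, 0 < t → φ t ≤ C * ψ t ∧ ψ t ≤ C * φ t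

/-- Slowly varying functions on `(0,∞)` (values outside `(0,∞)` are irrelevant). -/
structure IsSlowlyVarying (b : ℝ → ℝ) : Prop where
  /-- `b` is positive and finite. -/
  pos : ∀ t, 0 < t → 0 < b t
  /-- `b` is Lebesgue measurable on `(0,∞)`. -/
  aemeasurable : AEMeasurable b (volume.restrict (Ioi 0))
  /-- `t ^ ε * b t` is equivalent to an increasing function. -/
  equiv_increasing : ∀ ε : ℝ, 0 < ε →
    ∃ φ : ℝ → ℝ, MonotoneOn φ (Ioi 0) ∧ EquivOnPos (fun t => t ^ ε * b t) φ
  /-- `t ^ (-ε) * b t` is equivalent to a decreasing function. -/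
  equiv_decreasing : ∀ ε : ℝ, 0 < ε →
    ∃ φ : ℝ → ℝ, AntitoneOn φ (Ioi 0) ∧ EquivOnPos (fun t => t ^ (-ε) * b t) φ

/-- The reciprocal `1/q` as a real number, with `1/∞ = 0` (only used for `q ≠ 0`). -/
def recip (q : ℝ≥0∞) : ℝ := (q⁻¹).toReal

/-- The (quasi-)norm `‖g‖_{q,I}` of `L_q(I)` of a nonnegative function `g`, for `I ⊆ ℝ`. -/
def normOn (q : ℝ≥0∞) (I : Set ℝ) (g : ℝ → ℝ≥0∞) : ℝ≥0∞ :=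
  eLpNorm g q (volume.restrict I)

/-- The weight `t ^ α * b t`. -/
def weight (α : ℝ) (b : ℝ → ℝ) (t : ℝ) : ℝ≥0∞ := ENNReal.ofReal (t ^ α * b t)

/-- A space inside an ambient space `V`: its set of elements and its (quasi-)norm. -/
structure FnSpace (V : Type*) where
  /-- The elements of the space. -/
  carrier : Set V
  /-- The quasi-norm; only its values on `carrier` matter. -/
  qnorm : V → ℝ≥0∞

/-- The space of all elements of `V` on which `N` is finite. -/
def FnSpace.ofQNorm {V : Type*} (N : V → ℝ≥0∞) : FnSpace V where
  carrier := {f | N f < ∞}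
  qnorm := N

/-- Continuous embedding `X ⊂ Y`. -/
def FnSpace.Embeds {V : Type*} (X Y : FnSpace V) : Prop :=
  X.carrier ⊆ Y.carrier ∧ ∃ C : ℝ≥0, ∀ f ∈ X.carrier, Y.qnorm f ≤ C * X.qnorm f

/-- Equality of spaces in the sense of interpolation theory: same elements, equivalent
quasi-norms. -/
def FnSpace.Same {V : Type*} (X Y : FnSpace V) : Prop := X.Embeds Y ∧ Y.Embeds X

section Interpolation

variable {V : Type*} [AddCommGroup V]

/-- The elements of the sum `A₀ + A₁`. -/
def sumSet (A₀ A₁ : FnSpace V) : Set V :=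
  {f | ∃ f₀ ∈ A₀.carrier, ∃ f₁ ∈ A₁.carrier, f = f₀ + f₁}

/-- The Peetre `K`-functional `K(t,f;A₀,A₁)` (for `t > 0`). -/
def peetreK (A₀ A₁ : FnSpace V) (t : ℝ) (f : V) : ℝ≥0∞ :=
  ⨅ (f₀ ∈ A₀.carrier) (f₁ ∈ A₁.carrier) (_ : f = f₀ + f₁),
    A₀.qnorm f₀ + ENNReal.ofReal t * A₁.qnorm f₁

/-- The quasi-norm of the `𝓛` limiting interpolation space:
`‖ t^{-1/r} b(t) ‖ u^{-θ-1/q} a(u) K(u,f) ‖_{q,(0,t)} ‖_{r,(0,∞)}`. -/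
def interpLNorm (A₀ A₁ : FnSpace V) (θ : ℝ) (r : ℝ≥0∞) (b : ℝ → ℝ) (q : ℝ≥0∞) (a : ℝ → ℝ)
    (f : V) : ℝ≥0∞ :=
  normOn r (Ioi 0) fun t => weight (-recip r) b t *
    normOn q (Ioo 0 t) fun u => weight (-θ - recip q) a u * peetreK A₀ A₁ u f

/-- The `𝓛` limiting interpolation space `(A₀,A₁)^𝓛_{θ,r,b,q,a}`. -/
def interpL (A₀ A₁ : FnSpace V) (θ : ℝ) (r : ℝ≥0∞) (b : ℝ → ℝ) (q : ℝ≥0∞) (a : ℝ → ℝ) :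
    FnSpace V where
  carrier := {f ∈ sumSet A₀ A₁ | interpLNorm A₀ A₁ θ r b q a f < ∞}
  qnorm := interpLNorm A₀ A₁ θ r b q a

end Interpolation

section FunctionSpaces

variable {Ω : Type*} [MeasurableSpace Ω] {μ : Measure Ω} {𝕜 : Type*} [RCLike 𝕜]

/-- The non-increasing rearrangement `f*(t) = inf {s ≥ 0 : μ {|f| > s} ≤ t}` (`inf ∅ = ∞`). -/
def rearr (f : Ω →ₘ[μ] 𝕜) (t : ℝ) : ℝ≥0∞ :=
  sInf {s : ℝ≥0∞ | μ {x | s < ‖f x‖ₑ} ≤ ENNReal.ofReal t}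

/-- The maximal function `f**(t) = (1/t) ∫₀ᵗ f*(u) du` of `f*`. -/
def maxRearr (f : Ω →ₘ[μ] 𝕜) (t : ℝ) : ℝ≥0∞ :=
  (ENNReal.ofReal t)⁻¹ * ∫⁻ u in Ioo 0 t, rearr f u

variable (μ 𝕜)

/-- The Lebesgue space `L_p` on `(Ω,μ)`. -/
def lebesgue (p : ℝ≥0∞) : FnSpace (Ω →ₘ[μ] 𝕜) := .ofQNorm fun f => eLpNorm f p μ

/-- The Lorentz–Karamata space `L_{p,q;a}`. -/
def lorentzKaramata (p q : ℝ≥0∞) (a : ℝ → ℝ) : FnSpace (Ω →ₘ[μ] 𝕜) := .ofQNorm fun f =>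
  normOn q (Ioi 0) fun t => weight (recip p - recip q) a t * rearr f t

/-- The weak Lebesgue space `L_{1,∞}`. -/
def weakL1 : FnSpace (Ω →ₘ[μ] 𝕜) := lorentzKaramata μ 𝕜 1 ∞ (fun _ => 1)

/-- The space `L^𝓛_{p,r,b,q,a}`, defined through `f*`. -/
def lorentzL (p r : ℝ≥0∞) (b : ℝ → ℝ) (q : ℝ≥0∞) (a : ℝ → ℝ) : FnSpace (Ω →ₘ[μ] 𝕜) :=
  .ofQNorm fun f => normOn r (Ioi 0) fun t => weight (-recip r) b t *
    normOn q (Ioo 0 t) fun u => weight (recip p - recip q) a u * rearr f u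

/-- The space `(L)^𝓛_{p,r,b,q,a}`, defined through `f**`. -/
def maxLorentzL (p r : ℝ≥0∞) (b : ℝ → ℝ) (q : ℝ≥0∞) (a : ℝ → ℝ) : FnSpace (Ω →ₘ[μ] 𝕜) :=
  .ofQNorm fun f => normOn r (Ioi 0) fun t => weight (-recip r) b t *
    normOn q (Ioo 0 t) fun u => weight (recip p - recip q) a u * maxRearr f u

/-- The small Lorentz–Karamata space `L^{(p,q,r}_b`, defined through `f*`. -/
def smallStar (p q r : ℝ≥0∞) (b : ℝ → ℝ) : FnSpace (Ω →ₘ[μ] 𝕜) :=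
  .ofQNorm fun f => normOn r (Ioi 0) fun t => weight (-recip r) b t *
    normOn q (Ioo 0 t) fun u => ENNReal.ofReal (u ^ (recip p - recip q)) * rearr f u

/-- The small Lorentz–Karamata space `(L)^{(p,q,r}_b`, defined through `f**`. -/
def smallStarStar (p q r : ℝ≥0∞) (b : ℝ → ℝ) : FnSpace (Ω →ₘ[μ] 𝕜) :=
  .ofQNorm fun f => normOn r (Ioi 0) fun t => weight (-recip r) b t *
    normOn q (Ioo 0 t) fun u => ENNReal.ofReal (u ^ (recip p - recip q)) * maxRearr f u

end FunctionSpaces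

end LimitInterp

end

noncomputable section

namespace LimitInterp

/-! ### Norms on intervals -/

section Norms

/-! Everything rests on the pointwise chain `t f*(t) ≤ K(t,f;L_{1,∞},L_∞) ≤ K(t,f;L₁,L_∞) ≤ 2 t
f**(t)`. The first bound holds because an `L_∞` summand raises `f*` by at most its norm
(`rearr_add_le`), the last by truncating `f` at height `f*(t)` (`exists_eq_add_truncation`).

Inserting the chain into the two nested norms orders the four quasi-norms. The cycle is closed by a
Hardy inequality for the inner norm, uniform in `t` (`normOn_weight_maxRearr_le`). It is available
because the weight `u^(1/p-1/q)` satisfies `1/p = 1 - θ < 1`, and it holds even for `q < 1` because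
`f*` is nonincreasing. The factor `a` is absorbed by writing it as a small power times a
nonincreasing function. Membership in `A₀ + A₁` is automatic: a finite `f**` norm gives some `t`
with `f**(t) < ∞`, where truncation decomposes `f`. -/

theorem normOn_le_mul {q : ℝ≥0∞} {I : Set ℝ} (hI : MeasurableSet I) {g h : ℝ → ℝ≥0∞} (C : ℝ≥0)
    (hgh : ∀ t ∈ I, g t ≤ C * h t) : normOn q I g ≤ C * normOn q I h :=
  eLpNorm_le_mul_eLpNorm_of_ae_le_mul' (ae_restrict_of_forall_mem hI (by simpa using hgh)) q

theorem normOn_mono {q : ℝ≥0∞} {I : Set ℝ} (hI : MeasurableSet I) {g h : ℝ → ℝ≥0∞}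
    (hgh : ∀ t ∈ I, g t ≤ h t) : normOn q I g ≤ normOn q I h :=
  eLpNorm_mono_enorm_ae (ae_restrict_of_forall_mem hI (by simpa using hgh))

theorem normOn_congr {q : ℝ≥0∞} {I : Set ℝ} (hI : MeasurableSet I) {g h : ℝ → ℝ≥0∞}
    (hgh : ∀ t ∈ I, g t = h t) : normOn q I g = normOn q I h :=
  le_antisymm (normOn_mono hI fun t ht => (hgh t ht).le)
    (normOn_mono hI fun t ht => (hgh t ht).ge)

theorem normOn_eq_lintegral {q : ℝ≥0∞} (hq : q ≠ 0) (hq' : q ≠ ∞) (I : Set ℝ) (g : ℝ → ℝ≥0∞) :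
    normOn q I g = (∫⁻ t in I, g t ^ q.toReal) ^ (1 / q.toReal) := by
  simp [normOn, eLpNorm_eq_lintegral_rpow_enorm_toReal hq hq']

theorem normOn_eq_top {q : ℝ≥0∞} (hq : q ≠ 0) {I : Set ℝ} (hI : MeasurableSet I)
    (hvol : volume I ≠ 0) {g : ℝ → ℝ≥0∞} (hg : ∀ t ∈ I, g t = ∞) : normOn q I g = ∞ := by
  rw [normOn_congr hI hg, normOn, eLpNorm_const _ hq (by simpa using hvol)]
  rcases eq_or_ne q ∞ with rfl | hq'
  · simp
  · rw [enorm_eq_self, ENNReal.top_mul]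
    simp [ENNReal.rpow_eq_zero_iff, hvol, ENNReal.toReal_nonneg]

/-- A nonincreasing function times a power is bounded everywhere by its essential supremum. -/
theorem rpow_mul_le_normOn_top {β u : ℝ} (hu : 0 < u) {I : Set ℝ} (hI : Ioo 0 u ⊆ I)
    {G : ℝ → ℝ≥0∞} (hG : Antitone G) :
    ENNReal.ofReal (u ^ β) * G u ≤ normOn ∞ I fun s => ENNReal.ofReal (s ^ β) * G s := by
  set N := normOn ∞ I fun s => ENNReal.ofReal (s ^ β) * G s with hN
  have hae : ∀ᵐ s ∂(volume.restrict (Ioo 0 u)), ENNReal.ofReal (s ^ β) * G s ≤ N := by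
    have := enorm_ae_le_eLpNormEssSup (fun s => ENNReal.ofReal (s ^ β) * G s) (volume.restrict I)
    refine ae_mono (Measure.restrict_mono hI le_rfl) ?_
    simp only [enorm_eq_self] at this
    rw [hN, normOn, eLpNorm_exponent_top]
    exact this
  -- The a.e. bound holds at points `s < u` arbitrarily close to `u`, where `G u ≤ G s`; continuity
  -- of the power then allows `s → u`.
  have hfreq : ∃ᶠ s in nhdsWithin u (Iio u), ENNReal.ofReal (s ^ β) * G u ≤ N := by
    rw [Filter.frequently_iff]
    intro U hU
    obtain ⟨l, hl, hlU⟩ := (mem_nhdsLT_iff_exists_Ioo_subset' hu).1 hU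
    have hl' : l < u := hl
    have hsub : Ioo (max l 0) u ⊆ Ioo 0 u := Ioo_subset_Ioo_left (le_max_right _ _)
    have h2 : ∀ᵐ s ∂(volume.restrict (Ioo (max l 0) u)), ENNReal.ofReal (s ^ β) * G s ≤ N :=
      ae_mono (Measure.restrict_mono hsub le_rfl) hae
    have hne : (volume.restrict (Ioo (max l 0) u)) ≠ 0 := by
      rw [Ne, Measure.restrict_eq_zero, Real.volume_Ioo]
      simp [hl', hu]
    have : (ae (volume.restrict (Ioo (max l 0) u))).NeBot := ae_neBot.2 hne
    obtain ⟨s, hs, hs'⟩ := (h2.and (ae_restrict_mem measurableSet_Ioo)).exists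
    refine ⟨s, hlU ⟨(le_max_left _ _).trans_lt hs'.1, hs'.2⟩, le_trans ?_ hs⟩
    gcongr
    exact hG hs'.2.le
  have hcont : Filter.Tendsto (fun s : ℝ => ENNReal.ofReal (s ^ β) * G u) (nhdsWithin u (Iio u))
      (nhds (ENNReal.ofReal (u ^ β) * G u)) := by
    refine ENNReal.Tendsto.mul_const ?_ (Or.inl ?_)
    · exact (ENNReal.continuous_ofReal.tendsto _).comp
        ((Real.continuousAt_rpow_const u β (Or.inl hu.ne')).tendsto.mono_left nhdsWithin_le_nhds)
    · simpa using Real.rpow_pos_of_pos hu β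
  exact le_of_tendsto_of_frequently hcont hfreq

end Norms

/-! ### Nonincreasing rearrangement -/

section Rearrangement

variable {Ω : Type*} [MeasurableSpace Ω] {μ : Measure Ω} {𝕜 : Type*} [RCLike 𝕜]

theorem rearr_antitone (f : Ω →ₘ[μ] 𝕜) : Antitone (rearr f) := fun _ _ h =>
  sInf_le_sInf fun _ hs => le_trans hs (ENNReal.ofReal_le_ofReal h)

theorem measurable_enorm_aeEqFun (f : Ω →ₘ[μ] 𝕜) : Measurable fun x => ‖f x‖ₑ :=
  f.stronglyMeasurable.enorm

/-- The infimum defining the rearrangement is attained. -/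
theorem measure_rearr_lt_le (f : Ω →ₘ[μ] 𝕜) (t : ℝ) :
    μ {x | rearr f t < ‖f x‖ₑ} ≤ ENNReal.ofReal t := by
  rcases eq_or_ne (rearr f t) ∞ with h | h
  · simp [h]
  -- Levels decreasing to `f*(t)` exhaust the superlevel set, so continuity of the measure from
  -- below applies.
  obtain ⟨s, hs, hsI, hlim⟩ := exists_seq_strictAnti_tendsto' (lt_top_iff_ne_top.2 h)
  have hU : {x | rearr f t < ‖f x‖ₑ} = ⋃ n, {x | s n < ‖f x‖ₑ} := by
    ext x
    simp only [mem_ofPred_eq, mem_iUnion]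
    constructor
    · intro hx
      exact ((hlim.eventually (gt_mem_nhds hx))).exists
    · rintro ⟨n, hn⟩
      exact (hsI n).1.trans hn
  have hmono : Monotone fun n => {x | s n < ‖f x‖ₑ} := fun m n hmn x hx =>
    (hs.antitone hmn).trans_lt hx
  rw [hU, hmono.measure_iUnion]
  refine iSup_le fun n => ?_
  obtain ⟨v, hv, hvn⟩ := sInf_lt_iff.1 (hsI n).1
  exact (measure_mono fun x hx => hvn.trans hx).trans hv

/-- The rearrangement and the distribution function are generalized inverses; the nontrivial
direction is that the infimum is attained. -/
theorem lt_rearr_iff (f : Ω →ₘ[μ] 𝕜) (t : ℝ) (s : ℝ≥0∞) :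
    s < rearr f t ↔ ENNReal.ofReal t < μ {x | s < ‖f x‖ₑ} := by
  rw [← not_iff_not, not_lt, not_lt]
  refine ⟨fun h => ?_, fun h => sInf_le h⟩
  exact (measure_mono fun x hx => h.trans_lt hx).trans (measure_rearr_lt_le f t)

theorem rearr_add_le (f₀ f₁ : Ω →ₘ[μ] 𝕜) (t : ℝ) :
    rearr (f₀ + f₁) t ≤ rearr f₀ t + eLpNorm f₁ ∞ μ := by
  refine sInf_le (le_trans ?_ (measure_rearr_lt_le f₀ t))
  refine measure_mono_ae ?_
  filter_upwards [AEEqFun.coeFn_add f₀ f₁, enorm_ae_le_eLpNormEssSup f₁ μ] with x hx hx1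
  intro (h : _ < _)
  change rearr f₀ t < ‖f₀ x‖ₑ
  rw [hx] at h
  by_contra! hc
  refine absurd h (not_lt.2 ((enorm_add_le _ _).trans (add_le_add hc ?_)))
  rwa [eLpNorm_exponent_top]

/-- Chebyshev's inequality at each level `s < f*(t)`, whose superlevel set has measure greater than
`t`. -/
theorem ofReal_mul_rearr_le_eLpNorm_one (f : Ω →ₘ[μ] 𝕜) (t : ℝ) :
    ENNReal.ofReal t * rearr f t ≤ eLpNorm f 1 μ := by
  rw [eLpNorm_one_eq_lintegral_enorm, mul_comm]
  refine ENNReal.mul_le_of_forall_lt fun s hs v hv => ?_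
  have := (lt_rearr_iff f t s).1 hs
  calc s * v ≤ s * μ {x | s ≤ ‖f x‖ₑ} := by
        gcongr
        exact (hv.trans this).le.trans (measure_mono fun x hx => le_of_lt (α := ℝ≥0∞) hx)
    _ ≤ _ := mul_meas_ge_le_lintegral (measurable_enorm_aeEqFun f) s

theorem ofReal_mul_maxRearr (f : Ω →ₘ[μ] 𝕜) {t : ℝ} (ht : 0 < t) :
    ENNReal.ofReal t * maxRearr f t = ∫⁻ u in Ioo 0 t, rearr f u := by
  rw [maxRearr, ← mul_assoc, ENNReal.mul_inv_cancel (by simpa using ht) (by simp), one_mul]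

theorem ofReal_mul_rearr_le_lintegral (f : Ω →ₘ[μ] 𝕜) (t : ℝ) :
    ENNReal.ofReal t * rearr f t ≤ ∫⁻ u in Ioo 0 t, rearr f u := by
  calc _ = ∫⁻ u in Ioo 0 t, rearr f t := by simp [mul_comm]
    _ ≤ _ := setLIntegral_mono' measurableSet_Ioo fun u hu => rearr_antitone f hu.2.le

/-- The part of `f` above the level `f*(t)` has integral at most `∫₀ᵗ f*`. -/
theorem setLIntegral_enorm_le (f : Ω →ₘ[μ] 𝕜) (t : ℝ) :
    ∫⁻ x in {x | rearr f t < ‖f x‖ₑ}, ‖f x‖ₑ ∂μ ≤ ∫⁻ u in Ioo 0 t, rearr f u := by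
  rcases eq_or_ne (∫⁻ u in Ioo 0 t, rearr f u) ∞ with hfin | hfin
  · simp [hfin]
  have hmeas := (rearr_antitone f).measurable
  have hae : ∀ᵐ u ∂(volume.restrict (Ioo 0 t)), rearr f u < ∞ := ae_lt_top hmeas hfin
  have hset : MeasurableSet {x | rearr f t < ‖f x‖ₑ} :=
    measurableSet_lt measurable_const (measurable_enorm_aeEqFun f)
  calc ∫⁻ x in {x | rearr f t < ‖f x‖ₑ}, ‖f x‖ₑ ∂μ
      = ∫⁻ x in {x | rearr f t < ‖f x‖ₑ}, ENNReal.ofReal ‖f x‖ ∂μ := by simp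
    _ = ∫⁻ s in Ioi 0, μ.restrict {x | rearr f t < ‖f x‖ₑ} {x | s < ‖f x‖} :=
        lintegral_eq_lintegral_meas_lt _ (Filter.Eventually.of_forall fun _ => norm_nonneg _)
          f.stronglyMeasurable.norm.measurable.aemeasurable
    -- Layer-cake comparison: at level `s` the set on the left has measure `D ≤ t`, and `f* > s` on
    -- `(0, D)` by `lt_rearr_iff`, up to the null set where `f*` is infinite.
    _ ≤ ∫⁻ s in Ioi 0, volume.restrict (Ioo 0 t) {u | s < (rearr f u).toReal} := by
        refine setLIntegral_mono' measurableSet_Ioi fun s (hs : 0 < s) => ?_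
        rw [Measure.restrict_apply' hset]
        set D := μ ({x | s < ‖f x‖} ∩ {x | rearr f t < ‖f x‖ₑ}) with hD
        have hDt : D ≤ ENNReal.ofReal t :=
          (measure_mono inter_subset_right).trans (measure_rearr_lt_le f t)
        have hDtop : D ≠ ∞ := (hDt.trans_lt ENNReal.ofReal_lt_top).ne
        calc D = volume (Ioo 0 D.toReal) := by
              rw [Real.volume_Ioo, sub_zero, ENNReal.ofReal_toReal hDtop]
          _ = volume.restrict (Ioo 0 t) (Ioo 0 D.toReal) := by
              rw [Measure.restrict_apply measurableSet_Ioo, inter_eq_left.2]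
              intro u hu
              refine ⟨hu.1, ?_⟩
              have := ((ENNReal.ofReal_lt_iff_lt_toReal hu.1.le hDtop).2 hu.2).trans_le hDt
              exact (ENNReal.ofReal_lt_ofReal_iff_of_nonneg hu.1.le).1 this
          _ ≤ _ := by
              refine measure_mono_ae ?_
              filter_upwards [hae] with u hu
              intro (hu' : u ∈ Ioo 0 D.toReal)
              change s < (rearr f u).toReal
              rw [← ENNReal.ofReal_lt_iff_lt_toReal hs.le hu.ne, lt_rearr_iff]
              refine ((ENNReal.ofReal_lt_iff_lt_toReal hu'.1.le hDtop).2 hu'.2).trans_le ?_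
              refine measure_mono fun x hx => ?_
              change ENNReal.ofReal s < ‖f x‖ₑ
              rw [← ofReal_norm]
              exact (ENNReal.ofReal_lt_ofReal_iff_of_nonneg hs.le).2 hx.1
    _ = ∫⁻ u in Ioo 0 t, ENNReal.ofReal (rearr f u).toReal :=
        (lintegral_eq_lintegral_meas_lt _
          (Filter.Eventually.of_forall fun _ => ENNReal.toReal_nonneg)
          hmeas.ennreal_toReal.aemeasurable).symm
    _ ≤ _ := lintegral_mono fun u => ENNReal.ofReal_toReal_le

end Rearrangement

/-! ### Two-sided bounds for the K-functional -/

section KFunctional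

variable {Ω : Type*} [MeasurableSpace Ω] {μ : Measure Ω} {𝕜 : Type*} [RCLike 𝕜]

/-- Truncation at the level `f*(t)`. -/
theorem exists_eq_add_truncation (f : Ω →ₘ[μ] 𝕜) (t : ℝ) : ∃ f₀ f₁ : Ω →ₘ[μ] 𝕜, f = f₀ + f₁ ∧
    eLpNorm f₀ 1 μ ≤ ∫⁻ u in Ioo 0 t, rearr f u ∧ eLpNorm f₁ ∞ μ ≤ rearr f t := by
  set E := {x | rearr f t < ‖f x‖ₑ} with hE
  have hEm : MeasurableSet E := measurableSet_lt measurable_const (measurable_enorm_aeEqFun f)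
  have h₀ : AEStronglyMeasurable (E.indicator f) μ :=
    (f.stronglyMeasurable.indicator hEm).aestronglyMeasurable
  have h₁ : AEStronglyMeasurable (Eᶜ.indicator f) μ :=
    (f.stronglyMeasurable.indicator hEm.compl).aestronglyMeasurable
  refine ⟨AEEqFun.mk _ h₀, AEEqFun.mk _ h₁, ?_, ?_, ?_⟩
  · rw [AEEqFun.mk_add_mk]
    conv_lhs => rw [← AEEqFun.mk_coeFn f]
    congr 1
    exact (indicator_self_add_compl E f).symm
  · rw [eLpNorm_congr_ae (AEEqFun.coeFn_mk _ h₀), eLpNorm_indicator_eq_eLpNorm_restrict hEm,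
      eLpNorm_one_eq_lintegral_enorm]
    exact setLIntegral_enorm_le f t
  · rw [eLpNorm_congr_ae (AEEqFun.coeFn_mk _ h₁), eLpNorm_exponent_top]
    refine eLpNormEssSup_le_of_ae_enorm_bound (Filter.Eventually.of_forall fun x => ?_)
    by_cases hx : x ∈ E
    · simp [hx]
    · rw [indicator_of_mem (by exact hx)]
      exact not_lt.1 hx

theorem weakL1_qnorm (f : Ω →ₘ[μ] 𝕜) : (weakL1 μ 𝕜).qnorm f =
    normOn ∞ (Ioi 0) fun t => ENNReal.ofReal (t ^ (1 : ℝ)) * rearr f t := by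
  simp [weakL1, lorentzKaramata, FnSpace.ofQNorm, weight, recip]

theorem ofReal_mul_rearr_le_weakL1 (f : Ω →ₘ[μ] 𝕜) {t : ℝ} (ht : 0 < t) :
    ENNReal.ofReal t * rearr f t ≤ (weakL1 μ 𝕜).qnorm f := by
  rw [weakL1_qnorm]
  simpa using rpow_mul_le_normOn_top (β := 1) ht (I := Ioi 0) (fun s hs => hs.1) (rearr_antitone f)

theorem weakL1_le_eLpNorm_one (f : Ω →ₘ[μ] 𝕜) :
    (weakL1 μ 𝕜).qnorm f ≤ eLpNorm f 1 μ := by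
  rw [weakL1_qnorm, normOn, eLpNorm_exponent_top]
  refine eLpNormEssSup_le_of_ae_enorm_bound (Filter.Eventually.of_forall fun t => ?_)
  simpa using ofReal_mul_rearr_le_eLpNorm_one f t

theorem lebesgue_one_subset_weakL1 :
    (lebesgue μ 𝕜 1).carrier ⊆ (weakL1 μ 𝕜).carrier := fun f hf =>
  (weakL1_le_eLpNorm_one f).trans_lt hf

theorem ofReal_mul_rearr_le_peetreK (f : Ω →ₘ[μ] 𝕜) {t : ℝ} (ht : 0 < t) :
    ENNReal.ofReal t * rearr f t ≤ peetreK (weakL1 μ 𝕜) (lebesgue μ 𝕜 ∞) t f := by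
  refine le_iInf₂ fun f₀ _ => le_iInf₂ fun f₁ _ => le_iInf fun hf => ?_
  calc ENNReal.ofReal t * rearr f t ≤ ENNReal.ofReal t * (rearr f₀ t + eLpNorm f₁ ∞ μ) := by
        rw [hf]
        gcongr
        exact rearr_add_le f₀ f₁ t
    _ ≤ _ := by
        rw [mul_add]
        exact add_le_add (ofReal_mul_rearr_le_weakL1 f₀ ht) le_rfl

theorem peetreK_weakL1_le (f : Ω →ₘ[μ] 𝕜) (t : ℝ) :
    peetreK (weakL1 μ 𝕜) (lebesgue μ 𝕜 ∞) t f ≤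
      peetreK (lebesgue μ 𝕜 1) (lebesgue μ 𝕜 ∞) t f := by
  refine le_iInf₂ fun f₀ h₀ => le_iInf₂ fun f₁ h₁ => le_iInf fun hf => ?_
  refine (iInf₂_le f₀ (lebesgue_one_subset_weakL1 h₀)).trans ((iInf₂_le f₁ h₁).trans
    ((iInf_le _ hf).trans ?_))
  exact add_le_add (weakL1_le_eLpNorm_one f₀) le_rfl

/-- If `f**(t)` is finite, the truncation is a decomposition in `L₁ + L_∞`. -/
theorem exists_decomposition (f : Ω →ₘ[μ] 𝕜) {t : ℝ} (ht : 0 < t) (hf : maxRearr f t ≠ ∞) :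
    ∃ f₀ ∈ (lebesgue μ 𝕜 1).carrier, ∃ f₁ ∈ (lebesgue μ 𝕜 ∞).carrier, f = f₀ + f₁ ∧
      eLpNorm f₀ 1 μ + ENNReal.ofReal t * eLpNorm f₁ ∞ μ ≤
        2 * (ENNReal.ofReal t * maxRearr f t) := by
  obtain ⟨f₀, f₁, hadd, h₀, h₁⟩ := exists_eq_add_truncation f t
  rw [← ofReal_mul_maxRearr f ht] at h₀
  have hr : ENNReal.ofReal t * rearr f t ≤ ENNReal.ofReal t * maxRearr f t := by
    rw [ofReal_mul_maxRearr f ht]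
    exact ofReal_mul_rearr_le_lintegral f t
  have hfin : ENNReal.ofReal t * maxRearr f t < ∞ := ENNReal.mul_lt_top (by simp) hf.lt_top
  -- Finiteness of `f*(t)` puts the bounded part in `L_∞`.
  have h₁' : rearr f t < ∞ := ENNReal.lt_top_of_mul_ne_top_right (hr.trans_lt hfin).ne
    (by simpa using ht)
  refine ⟨f₀, h₀.trans_lt hfin, f₁, h₁.trans_lt h₁', hadd, ?_⟩
  rw [two_mul]
  exact add_le_add h₀ (le_trans (by gcongr) hr)

theorem peetreK_lebesgue_le (f : Ω →ₘ[μ] 𝕜) {t : ℝ} (ht : 0 < t) :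
    peetreK (lebesgue μ 𝕜 1) (lebesgue μ 𝕜 ∞) t f ≤ 2 * (ENNReal.ofReal t * maxRearr f t) := by
  by_cases hf : maxRearr f t = ∞
  · simp [hf, ENNReal.mul_top, ht]
  obtain ⟨f₀, h₀, f₁, h₁, hadd, hle⟩ := exists_decomposition f ht hf
  exact (iInf₂_le f₀ h₀).trans ((iInf₂_le f₁ h₁).trans ((iInf_le _ hadd).trans hle))

end KFunctional

/-! ### Hardy's inequality for nonincreasing functions -/

section Hardy

/-- The sum `∑ 2^{-(m+1)δ}`. -/
theorem tsum_two_rpow_lt_top {δ : ℝ} (hδ : 0 < δ) :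
    ∑' m : ℕ, ENNReal.ofReal (((1 / 2 : ℝ) ^ (m + 1)) ^ δ) < ∞ := by
  have hx : (1 / 2 : ℝ) ^ δ < 1 := Real.rpow_lt_one (by norm_num) (by norm_num) hδ
  have hx0 : (0 : ℝ) ≤ (1 / 2 : ℝ) ^ δ := by positivity
  have : ∀ m : ℕ, ENNReal.ofReal (((1 / 2 : ℝ) ^ (m + 1)) ^ δ) =
      ENNReal.ofReal ((1 / 2 : ℝ) ^ δ) * ENNReal.ofReal ((1 / 2 : ℝ) ^ δ) ^ m := fun m => by
    rw [← pow_succ', ← ENNReal.ofReal_pow hx0, ← Real.rpow_natCast, ← Real.rpow_natCast,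
      ← Real.rpow_mul (by norm_num), ← Real.rpow_mul (by norm_num), mul_comm]
  simp_rw [this]
  rw [ENNReal.tsum_mul_left, ENNReal.tsum_geometric]
  refine ENNReal.mul_lt_top (by simp) ?_
  rw [ENNReal.inv_lt_top, tsub_pos_iff_lt]
  simpa using hx

theorem setLIntegral_comp_mul_le {c : ℝ} (hc : 0 < c) (hc1 : c ≤ 1) (t : ℝ) {F : ℝ → ℝ≥0∞}
    (hF : Measurable F) :
    ENNReal.ofReal c * ∫⁻ u in Ioo 0 t, F (u * c) ≤ ∫⁻ u in Ioo 0 t, F u := by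
  rw [← lintegral_indicator measurableSet_Ioo, ← lintegral_indicator measurableSet_Ioo]
  conv_rhs => rw [← Real.smul_map_volume_mul_right hc.ne', abs_of_pos hc]
  rw [lintegral_smul_measure, smul_eq_mul,
    lintegral_map (hF.indicator measurableSet_Ioo) (measurable_mul_const c)]
  gcongr with u
  by_cases hu : u ∈ Ioo 0 t
  · rw [indicator_of_mem hu, indicator_of_mem]
    exact ⟨mul_pos hu.1 hc, (mul_le_of_le_one_right hu.1.le hc1).trans_lt hu.2⟩
  · simp [hu]

/-- On each dyadic interval `G` is at most its value at the left endpoint, and that endpoint equals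
the length. -/
theorem setLIntegral_le_tsum {G : ℝ → ℝ≥0∞} (hG : Antitone G) {u : ℝ} (hu : 0 < u) :
    ∫⁻ v in Ioo 0 u, G v ≤ ∑' m : ℕ, ENNReal.ofReal (u * (1 / 2) ^ (m + 1)) *
      G (u * (1 / 2) ^ (m + 1)) := by
  have hsub : Ioo 0 u ⊆ ⋃ m : ℕ, Ioc (u * (1 / 2) ^ (m + 1)) (u * (1 / 2) ^ m) := fun v hv => by
    obtain ⟨n, hn, hn'⟩ := exists_nat_pow_near_of_lt_one (div_pos hv.1 hu)
      ((div_le_one hu).2 hv.2.le) (by norm_num : (0 : ℝ) < 1 / 2) (by norm_num)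
    rw [lt_div_iff₀' hu] at hn
    rw [div_le_iff₀' hu] at hn'
    exact mem_iUnion.2 ⟨n, hn, hn'⟩
  refine (lintegral_mono_set hsub).trans ((lintegral_iUnion_le _ _).trans ?_)
  gcongr with m
  calc _ ≤ ∫⁻ v in Ioc (u * (1 / 2) ^ (m + 1)) (u * (1 / 2) ^ m), G (u * (1 / 2) ^ (m + 1)) :=
        setLIntegral_mono' measurableSet_Ioc fun v hv => hG hv.1.le
    _ = _ := by
        rw [setLIntegral_const, Real.volume_Ioc, mul_comm]
        congr 2
        ring

/-- With `c = 2^(-m-1)`, the point is `u^(β-1) · uc = c^(1-β) (uc)^β`: averaging becomes a sum of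
dilations with geometric weights. -/
theorem rpow_mul_average_le_tsum {G : ℝ → ℝ≥0∞} (hG : Antitone G) (β : ℝ) {u : ℝ} (hu : 0 < u) :
    ENNReal.ofReal (u ^ β) * ((ENNReal.ofReal u)⁻¹ * ∫⁻ v in Ioo 0 u, G v) ≤
      ∑' m : ℕ, ENNReal.ofReal (((1 / 2 : ℝ) ^ (m + 1)) ^ (1 - β)) *
        (ENNReal.ofReal ((u * (1 / 2) ^ (m + 1)) ^ β) * G (u * (1 / 2) ^ (m + 1))) := by
  refine (mul_le_mul_right (mul_le_mul_right (setLIntegral_le_tsum hG hu) _) _).trans ?_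
  rw [← ENNReal.tsum_mul_left, ← ENNReal.tsum_mul_left]
  refine ENNReal.tsum_le_tsum fun m => ?_
  have hc : (0 : ℝ) < (1 / 2) ^ (m + 1) := by positivity
  rw [← ENNReal.ofReal_inv_of_pos hu, ← mul_assoc, ← mul_assoc, ← mul_assoc,
    ← ENNReal.ofReal_mul (by positivity), ← ENNReal.ofReal_mul (by positivity),
    ← ENNReal.ofReal_mul (by positivity)]
  refine mul_le_mul' (ENNReal.ofReal_le_ofReal (le_of_eq ?_)) le_rfl
  rw [Real.mul_rpow hu.le hc.le, Real.rpow_sub hc, Real.rpow_one]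
  have := (Real.rpow_pos_of_pos hc β).ne'
  field_simp

/-- Hardy's inequality on `(0,t)` for nonincreasing functions and power weights, for all exponents
`0 < q ≤ ∞`, with a constant that does not depend on `t`. -/
theorem hardy_antitone {q : ℝ≥0∞} (hq : q ≠ 0) {β : ℝ} (hβ : β + recip q < 1) :
    ∃ C : ℝ≥0, ∀ (t : ℝ) (G : ℝ → ℝ≥0∞), Antitone G →
      normOn q (Ioo 0 t) (fun u => ENNReal.ofReal (u ^ β) *
          ((ENNReal.ofReal u)⁻¹ * ∫⁻ v in Ioo 0 u, G v)) ≤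
        C * normOn q (Ioo 0 t) fun u => ENNReal.ofReal (u ^ β) * G u := by
  -- The exponent `1 - β` is split in three: one `δ` makes `S` converge, `1/q` pays for the Jacobian
  -- of `u ↦ u c`, and for finite `q` the other `δ` makes `T` converge.
  obtain ⟨δ, hδ, hδβ⟩ : ∃ δ : ℝ, 0 < δ ∧ 1 - β = δ + (δ + recip q) :=
    ⟨(1 - β - recip q) / 2, by linarith, by ring⟩
  set c : ℕ → ℝ := fun m => (1 / 2 : ℝ) ^ (m + 1) with hc_def
  have hc0 : ∀ m, 0 < c m := fun m => by positivity
  have hc1 : ∀ m, c m ≤ 1 := fun m => pow_le_one₀ (by norm_num) (by norm_num)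
  set S := ∑' m : ℕ, ENNReal.ofReal (c m ^ δ) with hS_def
  have hS : S < ∞ := tsum_two_rpow_lt_top hδ
  have key : ∀ G : ℝ → ℝ≥0∞, Antitone G → ∀ u, 0 < u → ∀ M : ℝ≥0∞,
      (∀ m, ENNReal.ofReal (c m ^ (δ + recip q)) *
        (ENNReal.ofReal ((u * c m) ^ β) * G (u * c m)) ≤ M) →
      ENNReal.ofReal (u ^ β) * ((ENNReal.ofReal u)⁻¹ * ∫⁻ v in Ioo 0 u, G v) ≤ S * M := by
    intro G hG u hu M hM
    refine (rpow_mul_average_le_tsum hG β hu).trans ?_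
    rw [hS_def, ← ENNReal.tsum_mul_right]
    refine ENNReal.tsum_le_tsum fun m => ?_
    rw [hδβ, Real.rpow_add (hc0 m), ENNReal.ofReal_mul (by have := hc0 m; positivity), mul_assoc]
    gcongr
    exact hM m
  rcases eq_or_ne q ∞ with rfl | hq'
  · refine ⟨S.toNNReal, fun t G hG => ?_⟩
    rw [ENNReal.coe_toNNReal hS.ne]
    conv_lhs => rw [normOn, eLpNorm_exponent_top]
    refine eLpNormEssSup_le_of_ae_enorm_bound (ae_restrict_of_forall_mem measurableSet_Ioo
      fun u hu => ?_)
    rw [enorm_eq_self]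
    refine key G hG u hu.1 _ fun m => ?_
    have hle : u * c m ≤ u := mul_le_of_le_one_right hu.1.le (hc1 m)
    refine le_trans (mul_le_of_le_one_left' ?_) (rpow_mul_le_normOn_top (mul_pos hu.1 (hc0 m))
      (Ioo_subset_Ioo_right (hle.trans hu.2.le)) hG)
    rw [ENNReal.ofReal_le_one]
    exact Real.rpow_le_one (hc0 m).le (hc1 m) (by simp [recip, hδ.le])
  · set Q := q.toReal with hQ
    have hQ0 : 0 < Q := ENNReal.toReal_pos hq hq'
    have hrec : recip q = 1 / Q := by simp [recip, hQ, ENNReal.toReal_inv]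
    set T := ∑' m : ℕ, ENNReal.ofReal (c m ^ (δ * Q)) with hT_def
    have hT : T < ∞ := tsum_two_rpow_lt_top (mul_pos hδ hQ0)
    have hfin : (S ^ Q * T) ^ (1 / Q) ≠ ∞ := ENNReal.rpow_ne_top_of_nonneg (by positivity)
      (ENNReal.mul_ne_top (ENNReal.rpow_ne_top_of_nonneg hQ0.le hS.ne) hT.ne)
    refine ⟨((S ^ Q * T) ^ (1 / Q)).toNNReal, fun t G hG => ?_⟩
    rw [ENNReal.coe_toNNReal hfin, normOn_eq_lintegral hq hq', normOn_eq_lintegral hq hq',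
      ← ENNReal.mul_rpow_of_nonneg _ _ (by positivity)]
    refine ENNReal.rpow_le_rpow ?_ (by positivity)
    set h : ℝ → ℝ≥0∞ := fun u => (ENNReal.ofReal (u ^ β) * G u) ^ Q with hh
    have hmeas : Measurable h := by
      have := hG.measurable
      fun_prop
    have hterm : ∀ m u, (ENNReal.ofReal (c m ^ (δ + recip q)) *
        (ENNReal.ofReal ((u * c m) ^ β) * G (u * c m))) ^ Q =
        ENNReal.ofReal (c m ^ (δ * Q)) * (ENNReal.ofReal (c m) * h (u * c m)) := by
      intro m u
      have := hc0 m
      rw [ENNReal.mul_rpow_of_nonneg _ _ hQ0.le, ENNReal.ofReal_rpow_of_nonneg (by positivity)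
        hQ0.le, ← Real.rpow_mul this.le, add_mul, hrec, one_div, inv_mul_cancel₀ hQ0.ne',
        Real.rpow_add this, Real.rpow_one, ENNReal.ofReal_mul (by positivity), mul_assoc]
    calc _ ≤ ∫⁻ u in Ioo 0 t, S ^ Q * ∑' m, ENNReal.ofReal (c m ^ (δ * Q)) *
            (ENNReal.ofReal (c m) * h (u * c m)) := by
          refine setLIntegral_mono' measurableSet_Ioo fun u hu => ?_
          -- Each term is bounded by the `ℓ_Q` sum of all terms; this avoids the triangle inequality
          -- in `L_q`, which fails for `q < 1`.
          have hu' := key G hG u hu.1 ((∑' m, ENNReal.ofReal (c m ^ (δ * Q)) *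
            (ENNReal.ofReal (c m) * h (u * c m))) ^ (1 / Q)) fun m => by
              rw [one_div, ENNReal.le_rpow_inv_iff hQ0, hterm]
              exact ENNReal.le_tsum m
          refine (ENNReal.rpow_le_rpow hu' hQ0.le).trans_eq ?_
          rw [ENNReal.mul_rpow_of_nonneg _ _ hQ0.le, ← ENNReal.rpow_mul,
            one_div_mul_cancel hQ0.ne', ENNReal.rpow_one]
      _ = S ^ Q * ∑' m, ENNReal.ofReal (c m ^ (δ * Q)) *
            (ENNReal.ofReal (c m) * ∫⁻ u in Ioo 0 t, h (u * c m)) := by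
          have hcomp : ∀ m, Measurable fun u => h (u * c m) := fun m =>
            hmeas.comp (measurable_mul_const _)
          rw [lintegral_const_mul _ (Measurable.tsum fun m =>
            ((hcomp m).const_mul _).const_mul _), lintegral_tsum fun m =>
            (((hcomp m).const_mul _).const_mul _).aemeasurable]
          congr 2 with m
          rw [lintegral_const_mul _ ((hcomp m).const_mul _), lintegral_const_mul _ (hcomp m)]
      _ ≤ S ^ Q * ∑' m, ENNReal.ofReal (c m ^ (δ * Q)) * ∫⁻ u in Ioo 0 t, h u := by
          gcongr with m
          exact setLIntegral_comp_mul_le (hc0 m) (hc1 m) t hmeas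
      _ = _ := by rw [ENNReal.tsum_mul_right, mul_assoc]

end Hardy

/-! ### Slowly varying weights -/

section Weights

theorem isSlowlyVarying_one : IsSlowlyVarying fun _ => 1 where
  pos _ _ := one_pos
  aemeasurable := aemeasurable_const
  equiv_increasing ε hε := ⟨fun t => t ^ ε,
    fun _ hs _ _ hst => Real.rpow_le_rpow (le_of_lt hs) hst hε.le, 1, one_pos, fun t _ => by simp⟩
  equiv_decreasing ε hε := ⟨fun t => t ^ (-ε),
    fun _ hs _ _ hst => Real.rpow_le_rpow_of_nonpos hs hst (by linarith), 1, one_pos,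
    fun t _ => by simp⟩

theorem weight_mul_ofReal_mul (α : ℝ) (a : ℝ → ℝ) {u : ℝ} (hu : 0 < u) (x : ℝ≥0∞) :
    weight α a u * (ENNReal.ofReal u * x) = weight (1 + α) a u * x := by
  rw [weight, weight, ← mul_assoc, ← ENNReal.ofReal_mul' hu.le, Real.rpow_add hu, Real.rpow_one]
  ring_nf

theorem weight_ne_zero (α : ℝ) {a : ℝ → ℝ} (ha : IsSlowlyVarying a) {u : ℝ} (hu : 0 < u) :
    weight α a u ≠ 0 := by
  rw [weight, Ne, ENNReal.ofReal_eq_zero, not_le]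
  exact mul_pos (Real.rpow_pos_of_pos hu α) (ha.pos u hu)

/-- A weight with a slowly varying factor is a power times a nonincreasing function. -/
theorem exists_antitone_equiv_weight {a : ℝ → ℝ} (ha : IsSlowlyVarying a) {ε : ℝ} (hε : 0 < ε) :
    ∃ (C : ℝ≥0) (ψ : ℝ → ℝ≥0∞), Antitone ψ ∧ ∀ α u : ℝ, 0 < u →
      weight α a u ≤ C * (ENNReal.ofReal (u ^ (α + ε)) * ψ u) ∧
      ENNReal.ofReal (u ^ (α + ε)) * ψ u ≤ C * weight α a u := by
  obtain ⟨φ, hφ, C, hC, hCφ⟩ := ha.equiv_decreasing ε hε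
  -- The value `∞` off `(0,∞)` makes `ψ` antitone on the whole line.
  refine ⟨C.toNNReal, fun u => if 0 < u then ENNReal.ofReal (φ u) else ∞, fun u v huv => ?_,
    fun α u hu => ?_⟩
  · by_cases hu : 0 < u
    · have hv := hu.trans_le huv
      simp only [hu, hv, if_true]
      exact ENNReal.ofReal_le_ofReal (hφ hu hv huv)
    · simp [hu]
  · obtain ⟨h1, h2⟩ := hCφ u hu
    have hpow : u ^ α * a u = u ^ (α + ε) * (u ^ (-ε) * a u) := by
      rw [← mul_assoc, ← Real.rpow_add hu]
      ring_nf
    have hp : 0 < u ^ (α + ε) := Real.rpow_pos_of_pos hu _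
    have hcoe : ((C.toNNReal : ℝ≥0) : ℝ≥0∞) = ENNReal.ofReal C := rfl
    simp only [hu, if_true, weight, hcoe]
    rw [← ENNReal.ofReal_mul hp.le, ← ENNReal.ofReal_mul hC.le, ← ENNReal.ofReal_mul hC.le, hpow]
    constructor <;> refine ENNReal.ofReal_le_ofReal ?_
    · calc _ ≤ u ^ (α + ε) * (C * φ u) := by gcongr
        _ = _ := by ring
    · calc _ ≤ u ^ (α + ε) * (C * (u ^ (-ε) * a u)) := by gcongr
        _ = _ := by ring

variable {Ω : Type*} [MeasurableSpace Ω] {μ : Measure Ω} {𝕜 : Type*} [RCLike 𝕜]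

theorem normOn_weight_maxRearr_le {a : ℝ → ℝ} (ha : IsSlowlyVarying a) {q : ℝ≥0∞} (hq : q ≠ 0)
    {α : ℝ} (hα : α + recip q < 1) :
    ∃ C : ℝ≥0, ∀ (t : ℝ) (f : Ω →ₘ[μ] 𝕜),
      normOn q (Ioo 0 t) (fun u => weight α a u * maxRearr f u) ≤
        C * normOn q (Ioo 0 t) fun u => weight α a u * rearr f u := by
  obtain ⟨ε, hε, hε'⟩ : ∃ ε : ℝ, 0 < ε ∧ (α + ε) + recip q < 1 :=
    ⟨(1 - (α + recip q)) / 2, by linarith, by linarith⟩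
  obtain ⟨C, ψ, hψ, hC⟩ := exists_antitone_equiv_weight ha hε
  obtain ⟨D, hD⟩ := hardy_antitone hq hε'
  refine ⟨C * D * C, fun t f => ?_⟩
  have hG : Antitone fun u => ψ u * rearr f u := fun u v huv =>
    mul_le_mul' (hψ huv) (rearr_antitone f huv)
  calc _ ≤ C * normOn q (Ioo 0 t) (fun u => ENNReal.ofReal (u ^ (α + ε)) *
          ((ENNReal.ofReal u)⁻¹ * ∫⁻ v in Ioo 0 u, ψ v * rearr f v)) := by
        refine normOn_le_mul measurableSet_Ioo C fun u hu => ?_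
        -- Since `ψ` is nonincreasing it moves inside the average, and Hardy is applied to the
        -- nonincreasing product `ψ f*`.
        have hψint : ψ u * ∫⁻ v in Ioo 0 u, rearr f v ≤ ∫⁻ v in Ioo 0 u, ψ v * rearr f v := by
          rw [← lintegral_const_mul _ (rearr_antitone f).measurable]
          exact setLIntegral_mono' measurableSet_Ioo fun v hv =>
            mul_le_mul' (hψ hv.2.le) le_rfl
        calc _ ≤ C * (ENNReal.ofReal (u ^ (α + ε)) * ψ u) * maxRearr f u := by
              gcongr
              exact (hC α u hu.1).1
          _ = C * (ENNReal.ofReal (u ^ (α + ε)) * ((ENNReal.ofReal u)⁻¹ *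
                (ψ u * ∫⁻ v in Ioo 0 u, rearr f v))) := by
              rw [maxRearr]
              ring
          _ ≤ _ := by gcongr
    _ ≤ C * (D * normOn q (Ioo 0 t) fun u =>
          ENNReal.ofReal (u ^ (α + ε)) * (ψ u * rearr f u)) := by
        gcongr
        exact hD t _ hG
    _ ≤ C * (D * (C * normOn q (Ioo 0 t) fun u => weight α a u * rearr f u)) := by
        gcongr
        refine normOn_le_mul measurableSet_Ioo C fun u hu => ?_
        rw [← mul_assoc, ← mul_assoc]
        exact mul_le_mul' (hC α u hu.1).2 le_rfl
    _ = _ := by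
        push_cast
        ring

end Weights

/-! ### Comparison of the four spaces -/

section Spaces

variable {Ω : Type*} [MeasurableSpace Ω] {μ : Measure Ω} {𝕜 : Type*} [RCLike 𝕜]

theorem outer_norm_le_mul (r : ℝ≥0∞) (b : ℝ → ℝ) {g h : ℝ → ℝ≥0∞} (C : ℝ≥0)
    (hgh : ∀ t, 0 < t → g t ≤ C * h t) :
    normOn r (Ioi 0) (fun t => weight (-recip r) b t * g t) ≤
      C * normOn r (Ioi 0) fun t => weight (-recip r) b t * h t := by
  refine normOn_le_mul measurableSet_Ioi C fun t ht => ?_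
  rw [mul_left_comm]
  gcongr
  exact hgh t ht

/-- Used contrapositively: a finite norm yields a `t > 0` with `f**(t)` finite. -/
theorem maxLorentzL_qnorm_eq_top {p r q : ℝ≥0∞} (hq : q ≠ 0) (hr : r ≠ 0) {a b : ℝ → ℝ}
    (ha : IsSlowlyVarying a) (hb : IsSlowlyVarying b) {f : Ω →ₘ[μ] 𝕜}
    (hf : ∀ t, 0 < t → maxRearr f t = ∞) : (maxLorentzL μ 𝕜 p r b q a).qnorm f = ∞ := by
  refine normOn_eq_top hr measurableSet_Ioi (by simp) fun t (ht : 0 < t) => ?_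
  rw [normOn_eq_top hq measurableSet_Ioo (by simpa using ht) fun u hu => ?_,
    ENNReal.mul_top (weight_ne_zero _ hb ht)]
  rw [hf u hu.1, ENNReal.mul_top (weight_ne_zero _ ha hu.1)]

theorem mem_sumSet_of_maxLorentzL {p r q : ℝ≥0∞} (hq : q ≠ 0) (hr : r ≠ 0) {a b : ℝ → ℝ}
    (ha : IsSlowlyVarying a) (hb : IsSlowlyVarying b) {f : Ω →ₘ[μ] 𝕜}
    (hf : (maxLorentzL μ 𝕜 p r b q a).qnorm f < ∞) :
    f ∈ sumSet (lebesgue μ 𝕜 1) (lebesgue μ 𝕜 ∞) := by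
  by_contra hc
  refine hf.ne (maxLorentzL_qnorm_eq_top hq hr ha hb fun t ht => ?_)
  by_contra ht'
  obtain ⟨f₀, h₀, f₁, h₁, hadd, -⟩ := exists_decomposition f ht ht'
  exact hc ⟨f₀, h₀, f₁, h₁, hadd⟩

theorem sumSet_lebesgue_subset_weakL1 :
    sumSet (lebesgue μ 𝕜 1) (lebesgue μ 𝕜 ∞) ⊆ sumSet (weakL1 μ 𝕜) (lebesgue μ 𝕜 ∞) := by
  rintro f ⟨f₀, h₀, f₁, h₁, hadd⟩
  exact ⟨f₀, lebesgue_one_subset_weakL1 h₀, f₁, h₁, hadd⟩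

theorem lorentzL_le_interpL_weakL1 {p : ℝ≥0∞} {θ : ℝ} (hp : recip p = 1 - θ) (r : ℝ≥0∞)
    (b : ℝ → ℝ) (q : ℝ≥0∞) (a : ℝ → ℝ) (f : Ω →ₘ[μ] 𝕜) :
    (lorentzL μ 𝕜 p r b q a).qnorm f ≤
      interpLNorm (weakL1 μ 𝕜) (lebesgue μ 𝕜 ∞) θ r b q a f := by
  refine normOn_mono measurableSet_Ioi fun t _ => mul_le_mul_right
    (normOn_mono measurableSet_Ioo fun u hu => ?_) _
  have : recip p - recip q = 1 + (-θ - recip q) := by rw [hp]; ring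
  rw [this, ← weight_mul_ofReal_mul _ _ hu.1]
  gcongr
  exact ofReal_mul_rearr_le_peetreK f hu.1

theorem interpL_weakL1_le_interpL_lebesgue (θ : ℝ) (r : ℝ≥0∞) (b : ℝ → ℝ) (q : ℝ≥0∞) (a : ℝ → ℝ)
    (f : Ω →ₘ[μ] 𝕜) : interpLNorm (weakL1 μ 𝕜) (lebesgue μ 𝕜 ∞) θ r b q a f ≤
      interpLNorm (lebesgue μ 𝕜 1) (lebesgue μ 𝕜 ∞) θ r b q a f := by
  refine normOn_mono measurableSet_Ioi fun t _ => mul_le_mul_right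
    (normOn_mono measurableSet_Ioo fun u _ => ?_) _
  gcongr
  exact peetreK_weakL1_le f u

theorem interpL_lebesgue_le_maxLorentzL {p : ℝ≥0∞} {θ : ℝ} (hp : recip p = 1 - θ) (r : ℝ≥0∞)
    (b : ℝ → ℝ) (q : ℝ≥0∞) (a : ℝ → ℝ) (f : Ω →ₘ[μ] 𝕜) :
    interpLNorm (lebesgue μ 𝕜 1) (lebesgue μ 𝕜 ∞) θ r b q a f ≤
      (2 : ℝ≥0) * (maxLorentzL μ 𝕜 p r b q a).qnorm f := by
  refine outer_norm_le_mul r b 2 fun t _ => normOn_le_mul measurableSet_Ioo 2 fun u hu => ?_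
  have : recip p - recip q = 1 + (-θ - recip q) := by rw [hp]; ring
  rw [this, ← weight_mul_ofReal_mul _ _ hu.1, mul_left_comm]
  gcongr
  exact peetreK_lebesgue_le f hu.1

/-- Here `θ > 0` enters: Hardy's condition `(1/p - 1/q) + 1/q < 1` reads `1 - θ < 1`. -/
theorem maxLorentzL_le_lorentzL {p : ℝ≥0∞} {θ : ℝ} (hθ : 0 < θ) (hp : recip p = 1 - θ)
    (r : ℝ≥0∞) (b : ℝ → ℝ) {q : ℝ≥0∞} (hq : q ≠ 0) {a : ℝ → ℝ} (ha : IsSlowlyVarying a) :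
    ∃ C : ℝ≥0, ∀ f : Ω →ₘ[μ] 𝕜,
      (maxLorentzL μ 𝕜 p r b q a).qnorm f ≤ C * (lorentzL μ 𝕜 p r b q a).qnorm f := by
  obtain ⟨C, hC⟩ := normOn_weight_maxRearr_le (μ := μ) (𝕜 := 𝕜) ha hq
    (α := recip p - recip q) (by linarith)
  exact ⟨C, fun f => outer_norm_le_mul r b C fun t _ => hC t f⟩

theorem same_interpL_lorentzL {p : ℝ≥0∞} {θ : ℝ} (hθ : 0 < θ) (hp : recip p = 1 - θ)
    {q r : ℝ≥0∞} (hq : q ≠ 0) (hr : r ≠ 0) {a b : ℝ → ℝ} (ha : IsSlowlyVarying a)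
    (hb : IsSlowlyVarying b) :
    (interpL (lebesgue μ 𝕜 1) (lebesgue μ 𝕜 ∞) θ r b q a).Same
        (interpL (weakL1 μ 𝕜) (lebesgue μ 𝕜 ∞) θ r b q a) ∧
      (interpL (weakL1 μ 𝕜) (lebesgue μ 𝕜 ∞) θ r b q a).Same (maxLorentzL μ 𝕜 p r b q a) ∧
      (maxLorentzL μ 𝕜 p r b q a).Same (lorentzL μ 𝕜 p r b q a) := by
  obtain ⟨C, hC⟩ := maxLorentzL_le_lorentzL (μ := μ) (𝕜 := 𝕜) hθ hp r b hq ha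
  have h1 := lorentzL_le_interpL_weakL1 (μ := μ) (𝕜 := 𝕜) hp r b q a
  have h2 := interpL_weakL1_le_interpL_lebesgue (μ := μ) (𝕜 := 𝕜) θ r b q a
  have h3 := interpL_lebesgue_le_maxLorentzL (μ := μ) (𝕜 := 𝕜) hp r b q a
  have hmax : ∀ f : Ω →ₘ[μ] 𝕜, (maxLorentzL μ 𝕜 p r b q a).qnorm f ≤
      C * interpLNorm (weakL1 μ 𝕜) (lebesgue μ 𝕜 ∞) θ r b q a f := fun f =>
    (hC f).trans (mul_le_mul_right (h1 f) _)
  have hstar : ∀ f : Ω →ₘ[μ] 𝕜, (lorentzL μ 𝕜 p r b q a).qnorm f ≤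
      (2 : ℝ≥0) * (maxLorentzL μ 𝕜 p r b q a).qnorm f := fun f =>
    (h1 f).trans ((h2 f).trans (h3 f))
  have hweak : ∀ f : Ω →ₘ[μ] 𝕜, interpLNorm (lebesgue μ 𝕜 1) (lebesgue μ 𝕜 ∞) θ r b q a f ≤
      ((2 * C : ℝ≥0) : ℝ≥0∞) * interpLNorm (weakL1 μ 𝕜) (lebesgue μ 𝕜 ∞) θ r b q a f := fun f => by
    rw [ENNReal.coe_mul, mul_assoc]
    exact (h3 f).trans (mul_le_mul_right (hmax f) _)
  have fin : ∀ (K : ℝ≥0) {x y : ℝ≥0∞}, y ≤ K * x → x < ∞ → y < ∞ := fun K x y hxy hx =>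
    hxy.trans_lt (ENNReal.mul_lt_top ENNReal.coe_lt_top hx)
  have hsum := fun (f : Ω →ₘ[μ] 𝕜) => mem_sumSet_of_maxLorentzL (p := p) hq hr ha hb (f := f)
  refine ⟨⟨⟨fun f hf => ⟨sumSet_lebesgue_subset_weakL1 hf.1, (h2 f).trans_lt hf.2⟩,
      1, fun f _ => ?_⟩, ⟨fun f hf => ⟨hsum f (fin _ (hmax f) hf.2), fin _ (hweak f) hf.2⟩,
      2 * C, fun f _ => hweak f⟩⟩, ⟨⟨fun f hf => fin _ (hmax f) hf.2, C, fun f _ => hmax f⟩,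
      ⟨fun f hf => ⟨sumSet_lebesgue_subset_weakL1 (hsum f hf), ?_⟩,
        2, fun f _ => (h2 f).trans (h3 f)⟩⟩,
      ⟨⟨fun f hf => fin _ (hstar f) hf, 2, fun f _ => hstar f⟩,
        ⟨fun f hf => fin _ (hC f) hf, C, fun f _ => hC f⟩⟩⟩
  · rw [ENNReal.coe_one, one_mul]
    exact h2 f
  · exact fin 2 ((h2 f).trans (h3 f)) hf

theorem smallStar_eq_lorentzL (p q r : ℝ≥0∞) (b : ℝ → ℝ) :
    smallStar μ 𝕜 p q r b = lorentzL μ 𝕜 p r b q fun _ => 1 := by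
  simp [smallStar, lorentzL, weight]

theorem smallStarStar_eq_maxLorentzL (p q r : ℝ≥0∞) (b : ℝ → ℝ) :
    smallStarStar μ 𝕜 p q r b = maxLorentzL μ 𝕜 p r b q fun _ => 1 := by
  simp [smallStarStar, maxLorentzL, weight]

end Spaces

end LimitInterp

end

theorem theorem6p3 {Ω : Type*} [MeasurableSpace Ω] (μ : Measure Ω) [SigmaFinite μ]
    (hμ : LimitInterp.IsNonatomic μ) (𝕜 : Type*) [RCLike 𝕜]
    (θ : ℝ) (hθ₀ : 0 < θ) (hθ₁ : θ ≤ 1)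
    (p : ℝ≥0∞) (hp : p = 1 / ENNReal.ofReal (1 - θ))
    (q r : ℝ≥0∞) (hq : 0 < q) (hr : 0 < r)
    (a b : ℝ → ℝ) (ha : LimitInterp.IsSlowlyVarying a) (hb : LimitInterp.IsSlowlyVarying b) :
    ((LimitInterp.interpL (LimitInterp.lebesgue μ 𝕜 1) (LimitInterp.lebesgue μ 𝕜 ∞) θ r b q a).Same
        (LimitInterp.interpL (LimitInterp.weakL1 μ 𝕜) (LimitInterp.lebesgue μ 𝕜 ∞) θ r b q a) ∧
      (LimitInterp.interpL (LimitInterp.weakL1 μ 𝕜) (LimitInterp.lebesgue μ 𝕜 ∞) θ r b q a).Same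
        (LimitInterp.maxLorentzL μ 𝕜 p r b q a) ∧
      (LimitInterp.maxLorentzL μ 𝕜 p r b q a).Same (LimitInterp.lorentzL μ 𝕜 p r b q a)) ∧
    ((LimitInterp.interpL (LimitInterp.lebesgue μ 𝕜 1) (LimitInterp.lebesgue μ 𝕜 ∞)
          θ r b q (fun _ => 1)).Same
        (LimitInterp.interpL (LimitInterp.weakL1 μ 𝕜) (LimitInterp.lebesgue μ 𝕜 ∞)
          θ r b q (fun _ => 1)) ∧
      (LimitInterp.interpL (LimitInterp.weakL1 μ 𝕜) (LimitInterp.lebesgue μ 𝕜 ∞)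
          θ r b q (fun _ => 1)).Same (LimitInterp.smallStarStar μ 𝕜 p q r b) ∧
      (LimitInterp.smallStarStar μ 𝕜 p q r b).Same (LimitInterp.smallStar μ 𝕜 p q r b)) := by
  -- This includes `θ = 1`, where `p = 1/0 = ∞` and its reciprocal is `0`.
  have hp' : LimitInterp.recip p = 1 - θ := by
    rw [LimitInterp.recip, hp, one_div, inv_inv, ENNReal.toReal_ofReal (by linarith)]
  refine ⟨LimitInterp.same_interpL_lorentzL hθ₀ hp' hq.ne' hr.ne' ha hb, ?_⟩
  rw [LimitInterp.smallStarStar_eq_maxLorentzL, LimitInterp.smallStar_eq_lorentzL]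
  exact LimitInterp.same_interpL_lorentzL hθ₀ hp' hq.ne' hr.ne'
    LimitInterp.isSlowlyVarying_one hb
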